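/- Let $L\ge 1$ be an integer and let $t,\Delta,\mu,E_c,n_c$ be real numbers with $\Delta\neq 0$ and $E_c\ge 0$. Consider an open wire of $L$ sites with fermion operators $c_1,\dots,c_L$ and number operator $\hat N_w=\sum_{j=1}^{L} c_j^\dagger c_j$, coupled to a superconductor with Cooper pair number operator $\hat n$ (eigenbasis $|p\rangle$, $p\in\mathbb{Z}$, $\hat n|p\rangle=p|p\rangle$) and phase operator $\hat\phi$ (so $e^{i\hat\phi}|p\rangle=|p+1\rangle$). For $x\in\mathbb{R}$ let $$\hat H_{0,x}=-\frac t2\sum_{j=1}^{L-1}\big(c_j^\dagger c_{j+1}+\text{h.c.}\big)-\frac{\Delta}{2}\sum_{j=1}^{L-1}\big(c_jc_{j+1}e^{i\hat\phi}+\text{h.c.}\big)-x\Big(\hat N_w-\frac L2\Big),\qquad \hat H_x=\hat H_{0,x}+E_c\,(2\hat n-2n_c)^2 .$$ Let $M\in\mathbb{Z}$, and let the $M$-particle sector be the eigenspace of $\hat N_w+2\hat n$ with eigenvalue $M$. For $|x|<t$ the ground state of $\hat H_{0,x}$ in the $M$-particle sector exists and is unique up to a phase; let $f^{(M)}(x)$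 be the expectation value of $\hat N_w$ in this normalized ground state. Suppose that $|\mu|<t$ and $$-t+2E_cf^{(M)}(\mu)<\mu+2E_c(M-2n_c)<t+2E_cf^{(M)}(\mu).$$ Then there is a unique $\mu'\in(-t,t)$ with $$\mu+2E_c(M-2n_c)=\mu'+2E_cf^{(M)}(\mu').$$ Hence, within the $M$-particle sector, $$\hat H_\mu=\hat H_{0,\mu'}+E_c\big(\hat N_w-f^{(M)}(\mu')\big)^2+\mathcal C,\qquad \mathcal C=(\mu-\mu')\frac L2+E_c(M-2n_c)^2-E_c\,f^{(M)}(\mu')^2 .$$ -/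

import Mathlib

open scoped ComplexConjugate

noncomputable section

namespace Wire

/-- Finite linear combinations of the orthonormal basis states `|S⟩ ⊗ |p⟩`, where `S` is the set of
occupied sites of a wire with `L` sites and `p ∈ ℤ` is the number of Cooper pairs in the
superconductor. This is a dense common invariant domain of all operators below, in the Hilbert space
`Fock(ℂ^L) ⊗ ℓ²(ℤ)`. Every sector of fixed total particle number is spanned by finitely many of the
basis states, so it lies in this domain. -/
abbrev State (L : ℕ) : Type := (Finset (Fin L) × ℤ) →₀ ℂ

/-- The basis state `|S⟩ ⊗ |p⟩`. -/
def ket {L : ℕ} (S : Finset (Fin L)) (p : ℤ) : State L := Finsupp.single (S, p) 1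

/-- The Hermitian inner product `⟨ψ|φ⟩`, conjugate-linear in the first argument. -/
def braket {L : ℕ} (ψ φ : State L) : ℂ := ψ.sum fun b a => conj a * φ b

/-- The linear operator with prescribed values on the basis states. -/
def ofBasis {L : ℕ} (v : Finset (Fin L) → ℤ → State L) : Module.End ℂ (State L) :=
  Finsupp.linearCombination ℂ fun b => v b.1 b.2

/-- The fermionic sign `(-1)^(number of occupied sites to the left of j)`. -/
def fsign {L : ℕ} (j : Fin L) (S : Finset (Fin L)) : ℂ := (-1) ^ (S.filter fun k => k < j).card

/-- The fermion annihilation operator `c_j`. -/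
def c {L : ℕ} (j : Fin L) : Module.End ℂ (State L) :=
  ofBasis fun S p => if j ∈ S then fsign j S • ket (S.erase j) p else 0

/-- The fermion creation operator `c_j†`. -/
def cdag {L : ℕ} (j : Fin L) : Module.End ℂ (State L) :=
  ofBasis fun S p => if j ∈ S then 0 else fsign j S • ket (insert j S) p

/-- The operator `e^{iφ}`, which raises the number of Cooper pairs by one. -/
def expIPhi (L : ℕ) : Module.End ℂ (State L) := ofBasis fun S p => ket S (p + 1)

/-- The operator `e^{-iφ}`, which lowers the number of Cooper pairs by one. -/
def expNegIPhi (L : ℕ) : Module.End ℂ (State L) := ofBasis fun S p => ket S (p - 1)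

/-- The Cooper pair number operator. -/
def pairNumber (L : ℕ) : Module.End ℂ (State L) := ofBasis fun S p => (p : ℂ) • ket S p

/-- The wire particle number operator `N_w = ∑ j, c_j† c_j`. -/
def wireNumber (L : ℕ) : Module.End ℂ (State L) := ∑ j : Fin L, cdag j * c j

/-- The total particle number operator, each Cooper pair counting as two particles. -/
def totalNumber (L : ℕ) : Module.End ℂ (State L) := wireNumber L + (2 : ℂ) • pairNumber L

/-- The left end of the bond `j`. -/
def leftSite {L : ℕ} (j : Fin (L - 1)) : Fin L := ⟨j.1, by have := j.2; omega⟩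

/-- The right end of the bond `j`. -/
def rightSite {L : ℕ} (j : Fin (L - 1)) : Fin L := ⟨j.1 + 1, by have := j.2; omega⟩

/-- The number-conserving Hamiltonian without charging energy, on the open wire. -/
def H0 (L : ℕ) (t Δ μ : ℝ) : Module.End ℂ (State L) :=
  -((t / 2 : ℝ) : ℂ) • ∑ j : Fin (L - 1),
      (cdag (leftSite j) * c (rightSite j) + cdag (rightSite j) * c (leftSite j))
    - ((Δ / 2 : ℝ) : ℂ) • ∑ j : Fin (L - 1),
      (c (leftSite j) * c (rightSite j) * expIPhi L
        + expNegIPhi L * cdag (rightSite j) * cdag (leftSite j))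
    - (μ : ℂ) • (wireNumber L - ((L / 2 : ℝ) : ℂ) • 1)

/-- The charging energy `E_c (2 n - 2 n_c)²` of the superconductor. -/
def charging (L : ℕ) (Ec nc : ℝ) : Module.End ℂ (State L) :=
  (Ec : ℂ) • ((2 : ℂ) • pairNumber L - ((2 * nc : ℝ) : ℂ) • 1) ^ 2

/-- The full Hamiltonian. -/
def H (L : ℕ) (t Δ Ec nc μ : ℝ) : Module.End ℂ (State L) := H0 L t Δ μ + charging L Ec nc

/-- The sector of states with total particle number `M`. -/
def sector (L : ℕ) (M : ℤ) : Submodule ℂ (State L) :=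
  Module.End.eigenspace (totalNumber L) (M : ℂ)

/-- `χ` is a normalized ground state of `A` in the `M`-particle sector, that is, an eigenvector
in the sector whose eigenvalue is the lowest one among all eigenvectors in the sector. -/
def IsGroundState {L : ℕ} (A : Module.End ℂ (State L)) (M : ℤ) (χ : State L) : Prop :=
  χ ∈ sector L M ∧ braket χ χ = 1 ∧
    ∃ ε : ℝ, A χ = (ε : ℂ) • χ ∧
      ∀ (e : ℝ) (ψ : State L), ψ ∈ sector L M → ψ ≠ 0 → A ψ = (e : ℂ) • ψ → ε ≤ e

open Classical in
/-- The mean wire particle number `f^{(M)}(x) = ⟨χ|N_w|χ⟩`, with `χ` the ground state of `H_{0,x}` in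
the `M`-particle sector. -/
def meanWireNumber (L : ℕ) (t Δ : ℝ) (M : ℤ) (x : ℝ) : ℝ :=
  if h : ∃ χ : State L, IsGroundState (H0 L t Δ x) M χ then
    (braket h.choose (wireNumber L h.choose)).re
  else 0

end Wire

end

/-! Fixing `M` ties the number of Cooper pairs to the wire configuration, so the sector is finite
dimensional and `H0` acts on it as a real symmetric matrix. Every hopping or pairing term flips the
occupations at both ends of one bond. Nearest-neighbour hops carry no fermionic sign, and pairing
terms carry a uniform one, which the factor `gauge Δ ^ p` on states with `p` pairs absorbs. All
off-diagonal entries are then nonpositive. Flipping bonds connects any two configurations of equal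
parity, so a Perron–Frobenius argument makes the ground state unique up to a phase
(`isGroundState_iff`).

The chemical potential enters linearly, through a diagonal matrix. Comparing the variational
principles at two values of `x` shows that the mean particle number `f` is nondecreasing;
compactness together with uniqueness shows that it is continuous. Since `E_c ≥ 0`, `y + 2 E_c f(y)`
is strictly increasing and continuous, and the two inequalities bracket the required value inside
`(-t, t)` (`existsUnique_add_mul_eq`).

On the sector `2 n = M - N_w`, so the charging energy is a quadratic polynomial in `N_w`. The
equation for `μ'` is exactly the matching of its linear term with that of the square centred at
`f(μ')`. -/

namespace Matrix

open Filter Topology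

variable {ι : Type*} [Fintype ι]

/-! ### Perron–Frobenius theory for real symmetric matrices -/

/-- `u` satisfies the eigenvector equation of `A` for `ε`, and `ε` is a lower bound of the quadratic
form of `A`. -/
structure IsMinEigenvector (A : Matrix ι ι ℝ) (ε : ℝ) (u : ι → ℝ) : Prop where
  mulVec_eq : A *ᵥ u = ε • u
  le_form : ∀ w : ι → ℝ, ε * (w ⬝ᵥ w) ≤ w ⬝ᵥ A *ᵥ w

/-- The graph of the nonzero entries of `A` is connected: a predicate that propagates along the nonzero entries
holds everywhere once it holds somewhere. -/
def EntriesConnected (A : Matrix ι ι ℝ) : Prop :=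
  ∀ P : ι → Prop, (∀ i j, P i → A i j ≠ 0 → P j) → ∀ i j, P i → P j

lemma IsMinEigenvector.form_eq {A : Matrix ι ι ℝ} {ε : ℝ} {u : ι → ℝ}
    (h : A.IsMinEigenvector ε u) : u ⬝ᵥ A *ᵥ u = ε * (u ⬝ᵥ u) := by
  rw [h.mulVec_eq, dotProduct_smul, smul_eq_mul]

/-- `A - ε` is positive semidefinite, and a positive semidefinite matrix annihilates every vector at
which its quadratic form vanishes. -/
lemma mulVec_eq_of_form_eq {A : Matrix ι ι ℝ} (hA : A.IsSymm) {ε : ℝ} {u : ι → ℝ}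
    (hle : ∀ w : ι → ℝ, ε * (w ⬝ᵥ w) ≤ w ⬝ᵥ A *ᵥ w) (hu : u ⬝ᵥ A *ᵥ u = ε * (u ⬝ᵥ u)) :
    A *ᵥ u = ε • u := by
  classical
  have hform : ∀ w, w ⬝ᵥ (A - ε • (1 : Matrix ι ι ℝ)) *ᵥ w = w ⬝ᵥ A *ᵥ w - ε * (w ⬝ᵥ w) := by
    intro w
    simp [sub_mulVec, dotProduct_sub, smul_mulVec, dotProduct_smul]
  have hpsd : (A - ε • (1 : Matrix ι ι ℝ)).PosSemidef := by
    refine PosSemidef.of_dotProduct_mulVec_nonneg ?_ fun w => ?_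
    · have : A.IsHermitian := by
        rw [IsHermitian, conjTranspose_eq_transpose_of_trivial]; exact hA
      refine this.sub ?_
      rw [IsHermitian, conjTranspose_eq_transpose_of_trivial]
      simp
    · rw [star_trivial, hform]
      exact sub_nonneg.2 (hle w)
  have h0 := (hpsd.dotProduct_mulVec_zero_iff u).1 (by rw [star_trivial, hform, hu, sub_self])
  rw [sub_mulVec, smul_mulVec, one_mulVec] at h0
  exact sub_eq_zero.1 h0

lemma isCompact_unit_dotProduct : IsCompact {u : ι → ℝ | u ⬝ᵥ u = 1} := by
  refine Metric.isCompact_of_isClosed_isBounded ?_ ?_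
  · exact isClosed_eq (by unfold dotProduct; fun_prop) continuous_const
  · refine (Metric.isBounded_closedBall (x := (0 : ι → ℝ)) (r := 1)).subset fun u hu => ?_
    rw [mem_closedBall_zero_iff, pi_norm_le_iff_of_nonneg zero_le_one]
    intro i
    have h1 : u i * u i ≤ u ⬝ᵥ u :=
      Finset.single_le_sum (f := fun i => u i * u i) (fun j _ => mul_self_nonneg _)
        (Finset.mem_univ i)
    have hu' : u ⬝ᵥ u = 1 := hu
    rw [hu'] at h1
    rw [Real.norm_eq_abs]
    exact abs_le_one_iff_mul_self_le_one.2 h1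

/-- The quadratic form attains its minimum on the compact unit sphere; homogeneity extends the bound
to all vectors. -/
lemma exists_isMinEigenvector [Nonempty ι] {A : Matrix ι ι ℝ} (hA : A.IsSymm) :
    ∃ (ε : ℝ) (u : ι → ℝ), u ⬝ᵥ u = 1 ∧ A.IsMinEigenvector ε u := by
  classical
  have hne : {u : ι → ℝ | u ⬝ᵥ u = 1}.Nonempty :=
    ⟨Pi.single (Classical.arbitrary ι) 1, by simp⟩
  obtain ⟨u, hu, hmin⟩ := isCompact_unit_dotProduct.exists_isMinOn hne
    (f := fun u : ι → ℝ => u ⬝ᵥ A *ᵥ u)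
    (by unfold mulVec dotProduct; fun_prop)
  have hu' : u ⬝ᵥ u = 1 := hu
  have hle : ∀ w : ι → ℝ, (u ⬝ᵥ A *ᵥ u) * (w ⬝ᵥ w) ≤ w ⬝ᵥ A *ᵥ w := by
    intro w
    by_cases hw : w = 0
    · simp [hw]
    have hpos : 0 < w ⬝ᵥ w := by
      have h0 : 0 ≤ w ⬝ᵥ w := Finset.sum_nonneg fun i _ => mul_self_nonneg _
      exact lt_of_le_of_ne h0 fun h => hw (dotProduct_self_eq_zero.1 h.symm)
    set r := Real.sqrt (w ⬝ᵥ w) with hr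
    have hr2 : r * r = w ⬝ᵥ w := Real.mul_self_sqrt hpos.le
    have hr0 : r ≠ 0 := (Real.sqrt_pos.2 hpos).ne'
    have hm : r⁻¹ • w ∈ {u : ι → ℝ | u ⬝ᵥ u = 1} := by
      simp only [Set.mem_ofPred_eq, smul_dotProduct, dotProduct_smul, smul_eq_mul, ← hr2]
      field_simp
    have := hmin hm
    simp only [Set.mem_ofPred_eq, mulVec_smul, smul_dotProduct, dotProduct_smul,
      smul_eq_mul] at this
    rw [← hr2]
    calc (u ⬝ᵥ A *ᵥ u) * (r * r) ≤ r⁻¹ * (r⁻¹ * (w ⬝ᵥ A *ᵥ w)) * (r * r) :=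
          mul_le_mul_of_nonneg_right this (mul_self_nonneg r)
      _ = w ⬝ᵥ A *ᵥ w := by field_simp
  exact ⟨_, u, hu', mulVec_eq_of_form_eq hA hle (by rw [hu', mul_one]), hle⟩

/-- Taking absolute values keeps the norm and the diagonal terms, and can only lower the
off-diagonal terms, so the minimum is still attained. -/
lemma IsMinEigenvector.abs {A : Matrix ι ι ℝ} (hA : A.IsSymm)
    (hoff : ∀ i j, i ≠ j → A i j ≤ 0) {ε : ℝ} {u : ι → ℝ} (h : A.IsMinEigenvector ε u) :
    A.IsMinEigenvector ε fun i => |u i| := by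
  have hnorm : (fun i => |u i|) ⬝ᵥ (fun i => |u i|) = u ⬝ᵥ u :=
    Finset.sum_congr rfl fun i _ => abs_mul_abs_self _
  refine ⟨mulVec_eq_of_form_eq hA h.le_form (le_antisymm ?_ (h.le_form _)), h.le_form⟩
  rw [hnorm, ← h.form_eq]
  simp only [dotProduct, mulVec, Finset.mul_sum]
  refine Finset.sum_le_sum fun i _ => Finset.sum_le_sum fun j _ => ?_
  by_cases hij : i = j
  · subst hij
    refine le_of_eq ?_
    linear_combination A i i * abs_mul_abs_self (u i)
  · have h1 : u i * u j ≤ |u i| * |u j| := by rw [← abs_mul]; exact le_abs_self _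
    nlinarith [hoff i j hij]

/-- Where `|u|` vanishes, its eigenvector equation is a vanishing sum of nonpositive terms. Hence
`u` also vanishes at every neighbour, and by connectedness everywhere. -/
lemma IsMinEigenvector.eq_zero_of_apply_eq_zero {A : Matrix ι ι ℝ} (hA : A.IsSymm)
    (hoff : ∀ i j, i ≠ j → A i j ≤ 0) (hconn : A.EntriesConnected) {ε : ℝ} {u : ι → ℝ}
    (h : A.IsMinEigenvector ε u) {i : ι} (hi : u i = 0) : u = 0 := by
  have habs := (h.abs hA hoff).mulVec_eq
  have step : ∀ i j, u i = 0 → A i j ≠ 0 → u j = 0 := by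
    intro i j hi hij
    have h1 := congrFun habs i
    simp only [mulVec, dotProduct, Pi.smul_apply, hi, abs_zero, smul_zero] at h1
    have h2 : ∀ k ∈ Finset.univ, A i k * |u k| ≤ 0 := by
      intro k _
      by_cases hk : i = k
      · subst hk; simp [hi]
      · exact mul_nonpos_of_nonpos_of_nonneg (hoff i k hk) (abs_nonneg _)
    have h3 := (Finset.sum_eq_zero_iff_of_nonpos h2).1 h1 j (Finset.mem_univ j)
    simpa [hij] using h3
  funext j
  exact hconn (fun k => u k = 0) step i j hi

/-- Subtracting the multiple of `u` that kills one coordinate leaves an eigenvector with a zero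
entry, which must be zero. -/
lemma IsMinEigenvector.exists_eq_smul {A : Matrix ι ι ℝ} (hA : A.IsSymm)
    (hoff : ∀ i j, i ≠ j → A i j ≤ 0) (hconn : A.EntriesConnected) {ε : ℝ} {u v : ι → ℝ}
    (hu : A.IsMinEigenvector ε u) (hu0 : u ≠ 0) (hv : A *ᵥ v = ε • v) :
    ∃ r : ℝ, v = r • u := by
  obtain ⟨i, hi⟩ := Function.ne_iff.1 hu0
  refine ⟨v i / u i, ?_⟩
  have hw : A.IsMinEigenvector ε (v - (v i / u i) • u) := by
    refine ⟨?_, hu.le_form⟩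
    rw [mulVec_sub, mulVec_smul, hu.mulVec_eq, hv, smul_sub, smul_comm]
  refine sub_eq_zero.1 (hw.eq_zero_of_apply_eq_zero hA hoff hconn (i := i) ?_)
  have : u i ≠ 0 := hi
  simp only [Pi.sub_apply, Pi.smul_apply, smul_eq_mul]
  field_simp
  ring

lemma IsMinEigenvector.eigenvalue_le {A : Matrix ι ι ℝ} {ε e : ℝ} {u v : ι → ℝ}
    (hu : A.IsMinEigenvector ε u) (hv : A *ᵥ v = e • v) (hv0 : v ≠ 0) : ε ≤ e := by
  have h1 := hu.le_form v
  rw [hv, dotProduct_smul, smul_eq_mul] at h1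
  have h0 : 0 ≤ v ⬝ᵥ v := Finset.sum_nonneg fun i _ => mul_self_nonneg _
  exact le_of_mul_le_mul_right h1
    (lt_of_le_of_ne h0 fun h => hv0 (dotProduct_self_eq_zero.1 h.symm))

/-! ### Monotonicity and continuity of the ground-state mean -/

section Pencil

variable [DecidableEq ι]

/-- `m x` is the mean value of the diagonal observable `D` in a normalized lowest eigenvector of
`B - x D`, for every `x`. -/
def IsGroundMean (B : Matrix ι ι ℝ) (D : ι → ℝ) (m : ℝ → ℝ) : Prop :=
  ∀ x, ∃ (ε : ℝ) (u : ι → ℝ), u ⬝ᵥ u = 1 ∧ (B - x • diagonal D).IsMinEigenvector ε u ∧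
    m x = u ⬝ᵥ diagonal D *ᵥ u

variable {B : Matrix ι ι ℝ} {D : ι → ℝ} {m : ℝ → ℝ}

lemma pencil_form (B : Matrix ι ι ℝ) (D : ι → ℝ) (x : ℝ) (u : ι → ℝ) :
    u ⬝ᵥ (B - x • diagonal D) *ᵥ u = u ⬝ᵥ B *ᵥ u - x * (u ⬝ᵥ diagonal D *ᵥ u) := by
  rw [sub_mulVec, smul_mulVec, dotProduct_sub, dotProduct_smul, smul_eq_mul]

/-- Testing each ground state in the variational principle of the other and adding the two
inequalities gives `(y - x) * (m y - m x) ≥ 0`. -/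
lemma IsGroundMean.monotone (hm : IsGroundMean B D m) : Monotone m := by
  intro x y hxy
  rcases hxy.eq_or_lt with rfl | hlt
  · exact le_rfl
  obtain ⟨ε, u, hu, hε, hx⟩ := hm x
  obtain ⟨δ, v, hv, hδ, hy⟩ := hm y
  have h1 := hε.le_form v
  have h2 := hδ.le_form u
  have h3 := hε.form_eq
  have h4 := hδ.form_eq
  rw [pencil_form] at h1 h2 h3 h4
  rw [hv] at h1 h4
  rw [hu] at h2 h3
  rw [hx, hy]
  nlinarith

/-- Ground states along a convergent sequence of parameters subconverge to a unit vector. The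
variational inequality passes to the limit, so by uniqueness this vector is the ground state up to
sign, and the mean does not see the sign. -/
lemma IsGroundMean.continuous (hm : IsGroundMean B D m) (hB : B.IsSymm)
    (hoff : ∀ i j, i ≠ j → B i j ≤ 0) (hconn : ∀ x : ℝ, (B - x • diagonal D).EntriesConnected) :
    Continuous m := by
  rw [continuous_iff_seqContinuous]
  intro a x ha
  refine tendsto_of_subseq_tendsto fun ns hns => ?_
  choose ε u hu hε hmu using hm
  obtain ⟨v, hv, φ, hφ, hlim⟩ :=
    isCompact_unit_dotProduct.tendsto_subseq (x := fun n => u (a (ns n))) fun n => hu _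
  have hv' : v ⬝ᵥ v = 1 := hv
  refine ⟨φ, ?_⟩
  have hax : Tendsto (fun n => a (ns (φ n))) atTop (𝓝 x) :=
    ha.comp (hns.comp hφ.tendsto_atTop)
  have hB' : Continuous fun w : ι → ℝ => w ⬝ᵥ B *ᵥ w := by unfold mulVec dotProduct; fun_prop
  have hD : Continuous fun w : ι → ℝ => w ⬝ᵥ diagonal D *ᵥ w := by
    unfold mulVec dotProduct; fun_prop
  have hBv := (hB'.tendsto v).comp hlim
  have hDv := (hD.tendsto v).comp hlim
  -- The Rayleigh quotient of `v` serves as the eigenvalue, so convergence of the `ε` values is not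
  -- needed separately.
  have hle : ∀ w : ι → ℝ, (v ⬝ᵥ (B - x • diagonal D) *ᵥ v) * (w ⬝ᵥ w)
      ≤ w ⬝ᵥ (B - x • diagonal D) *ᵥ w := by
    intro w
    rw [pencil_form, pencil_form]
    refine le_of_tendsto_of_tendsto' ((hBv.sub (hax.mul hDv)).mul_const (w ⬝ᵥ w))
      (tendsto_const_nhds.sub (hax.mul_const (w ⬝ᵥ diagonal D *ᵥ w))) fun n => ?_
    have h1 := (hε (a (ns (φ n)))).le_form w
    have h2 := (hε (a (ns (φ n)))).form_eq
    rw [hu, mul_one] at h2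
    rw [← h2] at h1
    rwa [pencil_form, pencil_form] at h1
  have hsymm : (B - x • diagonal D).IsSymm := hB.sub ((isSymm_diagonal D).smul x)
  have hoff' : ∀ i j, i ≠ j → (B - x • diagonal D) i j ≤ 0 := by
    intro i j hij
    simpa [diagonal_apply_ne _ hij] using hoff i j hij
  have hvmin : (B - x • diagonal D).IsMinEigenvector _ v :=
    ⟨mulVec_eq_of_form_eq hsymm hle (by rw [hv', mul_one]), hle⟩
  have hu0 : u x ≠ 0 := fun h => by simpa [h] using hu x
  have hv0 : v ≠ 0 := fun h => by simp [h] at hv'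
  have he := le_antisymm (hvmin.eigenvalue_le (hε x).mulVec_eq hu0)
    ((hε x).eigenvalue_le hvmin.mulVec_eq hv0)
  obtain ⟨r, rfl⟩ := (hε x).exists_eq_smul hsymm hoff' (hconn x) hu0
    (he ▸ hvmin.mulVec_eq)
  have hr : r * r = 1 := by
    simpa [smul_dotProduct, dotProduct_smul, hu x] using hv'
  have hval : (r • u x) ⬝ᵥ diagonal D *ᵥ (r • u x) = m x := by
    rw [mulVec_smul, smul_dotProduct, dotProduct_smul, smul_smul, hr, one_smul, hmu]
  rw [hval] at hDv
  exact hDv.congr fun n => (hmu _).symm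

end Pencil

end Matrix

/-! ### Action of the operators on basis states -/

namespace Wire

variable {L : ℕ}

lemma ofBasis_ket (v : Finset (Fin L) → ℤ → State L) (S : Finset (Fin L)) (p : ℤ) :
    ofBasis v (ket S p) = v S p := by
  simp [ofBasis, ket]

lemma c_ket (j : Fin L) (S : Finset (Fin L)) (p : ℤ) :
    c j (ket S p) = if j ∈ S then fsign j S • ket (S.erase j) p else 0 := ofBasis_ket _ _ _

lemma cdag_ket (j : Fin L) (S : Finset (Fin L)) (p : ℤ) :
    cdag j (ket S p) = if j ∈ S then 0 else fsign j S • ket (insert j S) p := ofBasis_ket _ _ _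

lemma expIPhi_ket (S : Finset (Fin L)) (p : ℤ) : expIPhi L (ket S p) = ket S (p + 1) :=
  ofBasis_ket _ _ _

lemma expNegIPhi_ket (S : Finset (Fin L)) (p : ℤ) : expNegIPhi L (ket S p) = ket S (p - 1) :=
  ofBasis_ket _ _ _

lemma pairNumber_ket (S : Finset (Fin L)) (p : ℤ) :
    pairNumber L (ket S p) = (p : ℂ) • ket S p := ofBasis_ket _ _ _

lemma fsign_mul_self (j : Fin L) (S : Finset (Fin L)) : fsign j S * fsign j S = 1 := by
  rw [fsign, ← mul_pow]; norm_num

lemma fsign_congr {j : Fin L} {S T : Finset (Fin L)} (h : ∀ k < j, k ∈ S ↔ k ∈ T) :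
    fsign j S = fsign j T := by
  unfold fsign
  congr 2
  ext k
  simp only [Finset.mem_filter]
  exact and_congr_left (h k)

lemma leftSite_lt_rightSite (j : Fin (L - 1)) : leftSite j < rightSite j :=
  Fin.lt_def.2 (Nat.lt_succ_self _)

lemma lt_rightSite_iff {j : Fin (L - 1)} {k : Fin L} :
    k < rightSite j ↔ k < leftSite j ∨ k = leftSite j := by
  simp only [Fin.lt_def, Fin.ext_iff, leftSite, rightSite]
  omega

/-- The only site left of `rightSite j` but not left of `leftSite j` is `leftSite j` itself. All
sign cancellations in `hop_ket` and `pair_ket` rest on this. -/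
lemma fsign_rightSite (j : Fin (L - 1)) (S : Finset (Fin L)) :
    fsign (rightSite j) S
      = if leftSite j ∈ S then -fsign (leftSite j) S else fsign (leftSite j) S := by
  unfold fsign
  split_ifs with h
  · have : S.filter (fun k => k < rightSite j)
        = insert (leftSite j) (S.filter fun k => k < leftSite j) := by
      ext k
      simp only [Finset.mem_filter, Finset.mem_insert, lt_rightSite_iff]
      constructor
      · rintro ⟨h1, h2 | h2⟩
        · exact Or.inr ⟨h1, h2⟩
        · exact Or.inl h2
      · rintro (rfl | ⟨h1, h2⟩)
        · exact ⟨h, Or.inr rfl⟩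
        · exact ⟨h1, Or.inl h2⟩
    rw [this, Finset.card_insert_of_notMem (by simp), pow_succ]
    ring
  · have : S.filter (fun k => k < rightSite j) = S.filter fun k => k < leftSite j := by
      ext k
      simp only [Finset.mem_filter, lt_rightSite_iff]
      constructor
      · rintro ⟨h1, h2 | rfl⟩
        · exact ⟨h1, h2⟩
        · exact absurd h1 h
      · rintro ⟨h1, h2⟩
        exact ⟨h1, Or.inl h2⟩
    rw [this]

lemma wireNumber_ket (S : Finset (Fin L)) (p : ℤ) :
    wireNumber L (ket S p) = (S.card : ℂ) • ket S p := by
  have h : ∀ j : Fin L, (cdag j * c j) (ket S p) = if j ∈ S then ket S p else 0 := by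
    intro j
    rw [Module.End.mul_apply, c_ket]
    split_ifs with hj
    · rw [map_smul, cdag_ket, if_neg (by simp), smul_smul,
        fsign_congr (S := S.erase j) (T := S) (fun k hk => by simp [hk.ne]), fsign_mul_self,
        one_smul, Finset.insert_erase hj]
    · rw [map_zero]
  rw [wireNumber, LinearMap.sum_apply]
  simp only [h, Finset.sum_ite_mem, Finset.univ_inter, Finset.sum_const]
  exact (Nat.cast_smul_eq_nsmul ℂ _ _).symm

/-! ### Bond toggles and their connectivity -/

/-- The configuration obtained from `S` by changing the occupation of both ends of the bond `j`. -/
def toggle (j : Fin (L - 1)) (S : Finset (Fin L)) : Finset (Fin L) :=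
  symmDiff S {leftSite j, rightSite j}

lemma toggle_toggle (j : Fin (L - 1)) (S : Finset (Fin L)) : toggle j (toggle j S) = S :=
  symmDiff_symmDiff_cancel_right _ _

lemma leftSite_ne_rightSite (j : Fin (L - 1)) : leftSite j ≠ rightSite j :=
  (leftSite_lt_rightSite j).ne

lemma mem_toggle {j : Fin (L - 1)} {S : Finset (Fin L)} {k : Fin L} :
    k ∈ toggle j S ↔ (k ∈ S ∧ k ≠ leftSite j ∧ k ≠ rightSite j) ∨
      (k ∉ S ∧ (k = leftSite j ∨ k = rightSite j)) := by
  simp only [toggle, Finset.mem_symmDiff, Finset.mem_insert, Finset.mem_singleton]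
  tauto

lemma leftSite_mem_toggle {j : Fin (L - 1)} {S : Finset (Fin L)} :
    leftSite j ∈ toggle j S ↔ leftSite j ∉ S := by
  simp [mem_toggle]

lemma rightSite_mem_toggle {j : Fin (L - 1)} {S : Finset (Fin L)} :
    rightSite j ∈ toggle j S ↔ rightSite j ∉ S := by
  simp [mem_toggle]

lemma toggle_ne (j : Fin (L - 1)) (S : Finset (Fin L)) : toggle j S ≠ S := by
  intro h
  have := leftSite_mem_toggle (j := j) (S := S)
  rw [h] at this
  tauto

lemma hop_ket (j : Fin (L - 1)) (S : Finset (Fin L)) (p : ℤ) :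
    (cdag (leftSite j) * c (rightSite j) + cdag (rightSite j) * c (leftSite j)) (ket S p)
      = if leftSite j ∈ S ↔ rightSite j ∈ S then 0 else ket (toggle j S) p := by
  have hlr := leftSite_lt_rightSite j
  have hne := hlr.ne
  have hne' := hne.symm
  rw [LinearMap.add_apply, Module.End.mul_apply, Module.End.mul_apply, c_ket, c_ket]
  by_cases hl : leftSite j ∈ S <;> by_cases hr : rightSite j ∈ S
  · simp [hl, hr, cdag_ket, hne, hne']
  · have hs : insert (rightSite j) (S.erase (leftSite j)) = toggle j S := by
      ext k
      simp only [mem_toggle, Finset.mem_insert, Finset.mem_erase]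
      grind
    have hf : fsign (rightSite j) (S.erase (leftSite j)) = fsign (leftSite j) S := by
      rw [fsign_rightSite, if_neg (by simp)]
      exact fsign_congr fun k hk => by simp [hk.ne]
    simp [hl, hr, cdag_ket, hs, hf, smul_smul, fsign_mul_self]
  · have hs : insert (leftSite j) (S.erase (rightSite j)) = toggle j S := by
      ext k
      simp only [mem_toggle, Finset.mem_insert, Finset.mem_erase]
      grind
    have hf : fsign (leftSite j) (S.erase (rightSite j)) = fsign (leftSite j) S :=
      fsign_congr fun k hk => by simp [(hk.trans hlr).ne]
    have hf' : fsign (rightSite j) S = fsign (leftSite j) S := by rw [fsign_rightSite, if_neg hl]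
    simp [hl, hr, cdag_ket, hs, hf, hf', smul_smul, fsign_mul_self]
  · simp [hl, hr]

/-- Annihilating and creating a pair give the same sign: in both cases the right operator sees the
occupied left site, the left operator does not, and the remaining signs square to one. -/
lemma pair_ket (j : Fin (L - 1)) (S : Finset (Fin L)) (p : ℤ) :
    (c (leftSite j) * c (rightSite j) * expIPhi L
        + expNegIPhi L * cdag (rightSite j) * cdag (leftSite j)) (ket S p)
      = if leftSite j ∈ S ↔ rightSite j ∈ S then
          -ket (toggle j S) (if leftSite j ∈ S then p + 1 else p - 1) else 0 := by
  have hlr := leftSite_lt_rightSite j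
  have hne := hlr.ne
  have hne' := hne.symm
  simp only [LinearMap.add_apply, Module.End.mul_apply]
  rw [expIPhi_ket, c_ket, cdag_ket]
  by_cases hl : leftSite j ∈ S <;> by_cases hr : rightSite j ∈ S
  · have hs : (S.erase (rightSite j)).erase (leftSite j) = toggle j S := by
      ext k
      simp only [mem_toggle, Finset.mem_erase]
      grind
    have hf : fsign (leftSite j) (S.erase (rightSite j)) = fsign (leftSite j) S :=
      fsign_congr fun k hk => by simp [(hk.trans hlr).ne]
    have hf' : fsign (rightSite j) S = -fsign (leftSite j) S := by rw [fsign_rightSite, if_pos hl]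
    simp [hl, hr, c_ket, hs, hf, hf', hne, smul_smul, fsign_mul_self]
  · simp [hl, hr]
  · simp [hl, hr, c_ket, cdag_ket]
  · have hs : insert (rightSite j) (insert (leftSite j) S) = toggle j S := by
      ext k
      simp only [mem_toggle, Finset.mem_insert]
      grind
    have hf : fsign (rightSite j) (insert (leftSite j) S) = -fsign (leftSite j) S := by
      rw [fsign_rightSite, if_pos (by simp)]
      exact congrArg _ (fsign_congr fun k hk => by simp [hk.ne])
    simp [hl, hr, cdag_ket, expNegIPhi_ket, hs, hf, hne', smul_smul, fsign_mul_self]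

lemma card_toggle (j : Fin (L - 1)) (S : Finset (Fin L)) :
    ((toggle j S).card : ℤ) = S.card
      + if leftSite j ∈ S ↔ rightSite j ∈ S then (if leftSite j ∈ S then -2 else 2) else 0 := by
  have hsplit : ∀ T : Finset (Fin L), (T.card : ℤ)
      = ((T.erase (leftSite j)).erase (rightSite j)).card
        + (if leftSite j ∈ T then 1 else 0) + (if rightSite j ∈ T then 1 else 0) := by
    intro T
    have h1 := Finset.card_erase_add_one (s := T) (a := leftSite j)
    have h2 := Finset.card_erase_add_one (s := T.erase (leftSite j)) (a := rightSite j)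
    have h3 := Finset.mem_erase (s := T) (a := rightSite j) (b := leftSite j)
    have hne := (leftSite_ne_rightSite j).symm
    by_cases hl : leftSite j ∈ T <;> by_cases hr : rightSite j ∈ T <;>
      grind [Finset.erase_eq_of_notMem]
  have hrest : ((toggle j S).erase (leftSite j)).erase (rightSite j)
      = (S.erase (leftSite j)).erase (rightSite j) := by
    ext k
    simp only [mem_toggle, Finset.mem_erase]
    tauto
  rw [hsplit (toggle j S), hsplit S, hrest]
  simp only [leftSite_mem_toggle, rightSite_mem_toggle]
  by_cases hl : leftSite j ∈ S <;> by_cases hr : rightSite j ∈ S <;> simp [hl, hr] <;> ring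

/-- A predicate on configurations that is preserved by toggling bonds depends on the parity of the
number of particles only. -/
lemma toggle_connected (P : Finset (Fin L) → Prop) (hP : ∀ j S, P S → P (toggle j S))
    {S T : Finset (Fin L)} (hST : (2 : ℤ) ∣ S.card - T.card) (hS : P S) : P T := by
  have hiff : ∀ j S, P (toggle j S) ↔ P S := fun j S =>
    ⟨fun h => by simpa only [toggle_toggle] using hP j _ h, hP j S⟩
  -- Toggling the bond to the left of an occupied site other than the first either moves that
  -- particle left or removes a pair. Both lower the weight `∑ (k + 1)`, and the descent stops when
  -- at most the first site is occupied.
  have key : ∀ n : ℕ, ∀ S : Finset (Fin L), ∑ k ∈ S, (k.1 + 1) = n →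
      ∃ U : Finset (Fin L), (∀ k ∈ U, k.1 = 0) ∧ (P U ↔ P S) ∧ (2 : ℤ) ∣ S.card - U.card := by
    intro n
    induction n using Nat.strong_induction_on with
    | _ n ih =>
      intro S hn
      by_cases h : ∀ k ∈ S, k.1 = 0
      · exact ⟨S, h, Iff.rfl, by simp⟩
      push Not at h
      obtain ⟨k, hk, hk0⟩ := h
      obtain ⟨j, rfl⟩ : ∃ j : Fin (L - 1), rightSite j = k := by
        refine ⟨⟨k.1 - 1, by have := k.2; omega⟩, ?_⟩
        ext
        simp only [rightSite]
        omega
      have hlt : ∑ k ∈ toggle j S, (k.1 + 1) < n := by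
        rw [← hn, ← Finset.sum_erase_add _ _ hk]
        have hne := leftSite_ne_rightSite j
        have hval : (rightSite j).1 = (leftSite j).1 + 1 := rfl
        have hsub : toggle j S ⊆ insert (leftSite j) (S.erase (rightSite j)) := by
          intro k
          simp only [mem_toggle, Finset.mem_insert, Finset.mem_erase]
          grind
        by_cases hl : leftSite j ∈ S
        · have hsub' : toggle j S ⊆ S.erase (rightSite j) := by
            intro k
            simp only [mem_toggle, Finset.mem_erase]
            grind
          have := Finset.sum_le_sum_of_subset (f := fun k : Fin L => k.1 + 1) hsub'
          omega
        · have := Finset.sum_le_sum_of_subset (f := fun k : Fin L => k.1 + 1) hsub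
          rw [Finset.sum_insert (by simp [hl])] at this
          omega
      obtain ⟨U, hU, hPU, hpar⟩ := ih _ hlt (toggle j S) rfl
      refine ⟨U, hU, hPU.trans (hiff j S), ?_⟩
      have := card_toggle j S
      split_ifs at this <;> omega
  obtain ⟨U, hU, hPU, hpU⟩ := key _ S rfl
  obtain ⟨V, hV, hPV, hpV⟩ := key _ T rfl
  have hcard : ∀ W : Finset (Fin L), (∀ k ∈ W, k.1 = 0) → W.card ≤ 1 := fun W hW =>
    Finset.card_le_one.2 fun a ha b hb => Fin.ext ((hW a ha).trans (hW b hb).symm)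
  -- The reduced configurations have at most one particle, on the first site, so parity determines
  -- them.
  have hUV : U = V := by
    have h1 := hcard U hU
    have h2 := hcard V hV
    have h3 : U.card = V.card := by omega
    rcases U.eq_empty_or_nonempty with rfl | ⟨a, ha⟩
    · exact (Finset.card_eq_zero.1 (by simpa using h3.symm)).symm
    · have hp := Finset.card_pos.2 ⟨a, ha⟩
      obtain ⟨b, hb⟩ := Finset.card_pos.1 (h3 ▸ hp)
      have hab : a = b := Fin.ext ((hU a ha).trans (hV b hb).symm)
      subst hab
      ext k
      exact ⟨fun hk => (Fin.ext ((hU k hk).trans (hV a hb).symm) : k = a) ▸ hb,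
        fun hk => (Fin.ext ((hV k hk).trans (hU a ha).symm) : k = a) ▸ ha⟩
  exact hPV.1 (hUV ▸ hPU.2 hS)

end Wire

/-! ### The sector as a finite real matrix problem -/

namespace Wire

open Matrix

variable {L : ℕ} {M : ℤ}

/-- The wire configurations that occur in the `M`-particle sector. -/
abbrev Config (L : ℕ) (M : ℤ) : Type := {S : Finset (Fin L) // (2 : ℤ) ∣ M - S.card}

/-- The number of Cooper pairs in the sector state with wire configuration `S`. -/
def Config.pairs (S : Config L M) : ℤ := (M - S.1.card) / 2

lemma Config.card_add_pairs (S : Config L M) : (S.1.card : ℤ) + 2 * S.pairs = M := by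
  have := Int.mul_ediv_cancel' S.2
  rw [Config.pairs]
  omega

/-- Odd `M` forces a fermion in the wire, hence the need for a site. -/
lemma Config.nonempty (hL : 1 ≤ L) : Nonempty (Config L M) := by
  rcases Int.even_or_odd M with h | h
  · exact ⟨∅, by simpa using h.two_dvd⟩
  · refine ⟨{⟨0, hL⟩}, ?_⟩
    rw [Finset.card_singleton]
    obtain ⟨k, hk⟩ := h
    exact ⟨k, by rw [hk]; push_cast; ring⟩

/-- Toggling a bond inside the sector. -/
def Config.toggle (j : Fin (L - 1)) (S : Config L M) : Config L M :=
  ⟨Wire.toggle j S.1, by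
    have h1 := card_toggle j S.1
    have h2 := S.2
    split_ifs at h1 <;> omega⟩

lemma Config.toggle_toggle (j : Fin (L - 1)) (S : Config L M) : (S.toggle j).toggle j = S :=
  Subtype.ext (Wire.toggle_toggle j S.1)

lemma Config.toggle_ne (j : Fin (L - 1)) (S : Config L M) : S.toggle j ≠ S :=
  fun h => Wire.toggle_ne j S.1 (congrArg Subtype.val h)

lemma Config.pairs_toggle (j : Fin (L - 1)) (S : Config L M) :
    (S.toggle j).pairs = if leftSite j ∈ S.1 ↔ rightSite j ∈ S.1 then
      (if leftSite j ∈ S.1 then S.pairs + 1 else S.pairs - 1) else S.pairs := by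
  have h1 : ((S.toggle j).1.card : ℤ) = _ := card_toggle j S.1
  have h2 := S.card_add_pairs
  have h3 := (S.toggle j).card_add_pairs
  split_ifs at h1 ⊢ <;> omega

/-- The sign by which the `n`-pair states are multiplied to the power `n`, so that the pairing terms
get nonpositive matrix elements. -/
noncomputable def gauge (Δ : ℝ) : ℂ := if 0 < Δ then -1 else 1

lemma gauge_mul_self (Δ : ℝ) : gauge Δ * gauge Δ = 1 := by
  unfold gauge; split_ifs <;> norm_num

lemma gauge_ne_zero (Δ : ℝ) : gauge Δ ≠ 0 := by
  unfold gauge; split_ifs <;> norm_num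

lemma gauge_inv (Δ : ℝ) : (gauge Δ)⁻¹ = gauge Δ :=
  inv_eq_of_mul_eq_one_left (gauge_mul_self Δ)

lemma coe_mul_gauge (Δ : ℝ) : (Δ : ℂ) * gauge Δ = -((|Δ| : ℝ) : ℂ) := by
  unfold gauge
  split_ifs with h
  · rw [abs_of_pos h]; ring
  · rw [abs_of_nonpos (not_lt.1 h)]; push_cast; ring

lemma gauge_zpow_mul_self (Δ : ℝ) (p : ℤ) : gauge Δ ^ p * gauge Δ ^ p = 1 := by
  rw [← mul_zpow, gauge_mul_self, _root_.one_zpow]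

lemma conj_gauge_zpow (Δ : ℝ) (p : ℤ) : conj (gauge Δ ^ p) = gauge Δ ^ p := by
  have : conj (gauge Δ) = gauge Δ := by unfold gauge; split_ifs <;> simp
  rw [map_zpow₀, this]

/-- The basis state of the `M`-particle sector with wire configuration `S`. -/
noncomputable def sectorKet (Δ : ℝ) (S : Config L M) : State L := gauge Δ ^ S.pairs • ket S.1 S.pairs

/-- The state of the `M`-particle sector with given amplitudes. -/
noncomputable def embed (L : ℕ) (M : ℤ) (Δ : ℝ) : (Config L M → ℂ) →ₗ[ℂ] State L :=
  Fintype.linearCombination ℂ (sectorKet Δ)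

lemma embed_eq_sum (Δ : ℝ) (v : Config L M → ℂ) :
    embed L M Δ v = ∑ S, v S • sectorKet Δ S := Fintype.linearCombination_apply _ _ _

lemma embed_apply_pairs (Δ : ℝ) (v : Config L M → ℂ) (S : Config L M) :
    embed L M Δ v (S.1, S.pairs) = v S * gauge Δ ^ S.pairs := by
  rw [embed_eq_sum, Finsupp.finsetSum_apply, Finset.sum_eq_single S]
  · simp [sectorKet, ket]
  · intro T _ hT
    have : (T.1, T.pairs) ≠ (S.1, S.pairs) := fun h => hT (Subtype.ext (Prod.ext_iff.1 h).1)
    simp [sectorKet, ket, Finsupp.single_eq_of_ne this.symm]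
  · simp

lemma embed_apply_of_ne (Δ : ℝ) (v : Config L M → ℂ) {S : Finset (Fin L)} {p : ℤ}
    (h : (S.card : ℤ) + 2 * p ≠ M) : embed L M Δ v (S, p) = 0 := by
  rw [embed_eq_sum, Finsupp.finsetSum_apply]
  refine Finset.sum_eq_zero fun T _ => ?_
  have : (T.1, T.pairs) ≠ (S, p) := by
    intro hT
    obtain ⟨rfl, rfl⟩ := Prod.ext_iff.1 hT
    exact h T.card_add_pairs
  simp [sectorKet, ket, Finsupp.single_eq_of_ne this.symm]

lemma embed_injective (Δ : ℝ) : Function.Injective (embed L M Δ) := by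
  intro v w h
  funext S
  have := DFunLike.congr_fun h (S.1, S.pairs)
  rw [embed_apply_pairs, embed_apply_pairs] at this
  exact mul_right_cancel₀ (zpow_ne_zero _ (gauge_ne_zero Δ)) this

/-- The gauge factors are signs, so the vectors `sectorKet` stay orthonormal. -/
lemma braket_embed (Δ : ℝ) (v w : Config L M → ℂ) :
    braket (embed L M Δ v) (embed L M Δ w) = ∑ S, conj (v S) * w S := by
  let e : Config L M ↪ Finset (Fin L) × ℤ :=
    ⟨fun S => (S.1, S.pairs), fun S T h => Subtype.ext (Prod.ext_iff.1 h).1⟩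
  have hsupp : (embed L M Δ v).support ⊆ Finset.univ.map e := by
    rintro ⟨S, p⟩ hS
    rw [Finsupp.mem_support_iff] at hS
    have hM : (S.card : ℤ) + 2 * p = M := by
      by_contra h
      exact hS (embed_apply_of_ne Δ v h)
    refine Finset.mem_map.2 ⟨⟨S, p, by omega⟩, Finset.mem_univ _, Prod.ext rfl ?_⟩
    change (M - (S.card : ℤ)) / 2 = p
    omega
  rw [braket, Finsupp.sum_of_support_subset _ hsupp _ (by simp), Finset.sum_map]
  refine Finset.sum_congr rfl fun S _ => ?_
  change conj (embed L M Δ v (S.1, S.pairs)) * embed L M Δ w (S.1, S.pairs) = _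
  rw [embed_apply_pairs, embed_apply_pairs, map_mul, conj_gauge_zpow]
  linear_combination (conj (v S) * w S) * gauge_zpow_mul_self Δ S.pairs

lemma totalNumber_ket (S : Finset (Fin L)) (p : ℤ) :
    totalNumber L (ket S p) = ((S.card + 2 * p : ℤ) : ℂ) • ket S p := by
  rw [totalNumber, LinearMap.add_apply, LinearMap.smul_apply, wireNumber_ket, pairNumber_ket,
    smul_smul, ← add_smul]
  push_cast
  rfl

lemma totalNumber_apply (ψ : State L) (S : Finset (Fin L)) (p : ℤ) :
    totalNumber L ψ (S, p) = ((S.card + 2 * p : ℤ) : ℂ) * ψ (S, p) := by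
  induction ψ using Finsupp.induction_linear with
  | zero => simp
  | add f g hf hg => rw [map_add, Finsupp.add_apply, Finsupp.add_apply, hf, hg, mul_add]
  | single b a =>
    obtain ⟨T, q⟩ := b
    have : (Finsupp.single (T, q) a : State L) = a • ket T q := by simp [ket]
    rw [this, map_smul, totalNumber_ket, Finsupp.smul_apply, Finsupp.smul_apply,
      Finsupp.smul_apply]
    by_cases h : (T, q) = (S, p)
    · obtain ⟨rfl, rfl⟩ := Prod.ext_iff.1 h
      simp only [smul_eq_mul]
      ring
    · simp [ket, Finsupp.single_eq_of_ne (Ne.symm h)]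

lemma mem_sector_iff_exists_embed (Δ : ℝ) {ψ : State L} :
    ψ ∈ sector L M ↔ ∃ v, ψ = embed L M Δ v := by
  rw [sector, Module.End.mem_eigenspace_iff]
  constructor
  · intro h
    refine ⟨fun S => ψ (S.1, S.pairs) * gauge Δ ^ S.pairs, ?_⟩
    ext ⟨S, p⟩
    by_cases hM : (S.card : ℤ) + 2 * p = M
    · obtain ⟨T, rfl, rfl⟩ : ∃ T : Config L M, T.1 = S ∧ T.pairs = p :=
        ⟨⟨S, p, by omega⟩, rfl, by change (M - (S.card : ℤ)) / 2 = p; omega⟩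
      rw [embed_apply_pairs, mul_assoc, gauge_zpow_mul_self, mul_one]
    · rw [embed_apply_of_ne Δ _ hM]
      have h1 := DFunLike.congr_fun h (S, p)
      rw [totalNumber_apply, Finsupp.smul_apply, smul_eq_mul, ← sub_eq_zero, ← sub_mul] at h1
      refine (mul_eq_zero.1 h1).resolve_left fun h2 => hM ?_
      exact_mod_cast sub_eq_zero.1 h2
  · rintro ⟨v, rfl⟩
    ext ⟨S, p⟩
    rw [totalNumber_apply, Finsupp.smul_apply, smul_eq_mul]
    by_cases hM : (S.card : ℤ) + 2 * p = M
    · rw [hM]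
    · rw [embed_apply_of_ne Δ v hM, mul_zero, mul_zero]

lemma wireNumber_embed (Δ : ℝ) (v : Config L M → ℂ) :
    wireNumber L (embed L M Δ v) = embed L M Δ fun S => (S.1.card : ℂ) * v S := by
  rw [embed_eq_sum, embed_eq_sum, map_sum]
  refine Finset.sum_congr rfl fun S _ => ?_
  rw [sectorKet, map_smul, map_smul, wireNumber_ket]
  module

/-- The strength of the term of the Hamiltonian that toggles the bond `j` in the state `S`. -/
noncomputable def bondWeight (t Δ : ℝ) (j : Fin (L - 1)) (S : Finset (Fin L)) : ℝ :=
  if leftSite j ∈ S ↔ rightSite j ∈ S then |Δ| / 2 else t / 2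

lemma bondWeight_toggle (t Δ : ℝ) (j : Fin (L - 1)) (S : Finset (Fin L)) :
    bondWeight t Δ j (toggle j S) = bondWeight t Δ j S := by
  simp only [bondWeight, leftSite_mem_toggle, rightSite_mem_toggle, not_iff_not]

lemma bondWeight_pos {t Δ : ℝ} (ht : 0 < t) (hΔ : Δ ≠ 0) (j : Fin (L - 1))
    (S : Finset (Fin L)) : 0 < bondWeight t Δ j S := by
  unfold bondWeight
  have := abs_pos.2 hΔ
  split_ifs <;> positivity

/-- The matrix of hopping and pairing in the basis `sectorKet`. -/
noncomputable def bondMatrix (L : ℕ) (M : ℤ) (t Δ : ℝ) : Matrix (Config L M) (Config L M) ℝ :=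
  .of fun S T => -∑ j, if T.toggle j = S then bondWeight t Δ j T.1 else 0

/-- The wire particle number, measured from half filling. -/
noncomputable def filling (L : ℕ) (M : ℤ) (S : Config L M) : ℝ := S.1.card - L / 2

/-- The matrix of `H0` in the basis `sectorKet`. -/
noncomputable def sectorMatrix (L : ℕ) (M : ℤ) (t Δ x : ℝ) : Matrix (Config L M) (Config L M) ℝ :=
  bondMatrix L M t Δ - x • diagonal (filling L M)

lemma H0_sectorKet (t Δ x : ℝ) (S : Config L M) :
    H0 L t Δ x (sectorKet Δ S)
      = -∑ j, (bondWeight t Δ j S.1 : ℂ) • sectorKet Δ (S.toggle j)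
        - ((x * filling L M S : ℝ) : ℂ) • sectorKet Δ S := by
  have hbond : ∀ j : Fin (L - 1),
      ((t / 2 : ℝ) : ℂ) • (cdag (leftSite j) * c (rightSite j)
          + cdag (rightSite j) * c (leftSite j)) (sectorKet Δ S)
        + ((Δ / 2 : ℝ) : ℂ) • (c (leftSite j) * c (rightSite j) * expIPhi L
          + expNegIPhi L * cdag (rightSite j) * cdag (leftSite j)) (sectorKet Δ S)
        = (bondWeight t Δ j S.1 : ℂ) • sectorKet Δ (S.toggle j) := by
    intro j
    have hg := gauge_ne_zero Δ
    have hc := coe_mul_gauge Δ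
    have hcoe : (S.toggle j).1 = toggle j S.1 := rfl
    rw [sectorKet, map_smul, map_smul, hop_ket, pair_ket, sectorKet, Config.pairs_toggle, hcoe,
      bondWeight]
    by_cases h : leftSite j ∈ S.1 ↔ rightSite j ∈ S.1
    · simp only [if_pos h, smul_zero, zero_add, smul_neg, smul_smul, ← neg_smul]
      congr 1
      push_cast
      -- Raising and lowering the pair number produce the same factor, because `gauge Δ` is its own
      -- inverse.
      split_ifs
      · rw [zpow_add_one₀ hg]
        linear_combination (-(gauge Δ ^ S.pairs * gauge Δ / 2)) * hc
          + (gauge Δ ^ S.pairs * Δ / 2) * gauge_mul_self Δ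
      · rw [zpow_sub_one₀ hg, gauge_inv]
        linear_combination (-(gauge Δ ^ S.pairs * gauge Δ / 2)) * hc
          + (gauge Δ ^ S.pairs * Δ / 2) * gauge_mul_self Δ
    · simp only [if_neg h, smul_zero, add_zero]
  have hN : wireNumber L (sectorKet Δ S) = (S.1.card : ℂ) • sectorKet Δ S := by
    rw [sectorKet, map_smul, wireNumber_ket, smul_comm]
  rw [← Finset.sum_congr rfl fun j _ => hbond j, Finset.sum_add_distrib, ← Finset.smul_sum,
    ← Finset.smul_sum, ← LinearMap.sum_apply, ← LinearMap.sum_apply, H0, filling]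
  simp only [LinearMap.sub_apply, LinearMap.smul_apply, Module.End.one_apply, hN]
  push_cast
  module

lemma H0_embed (t Δ x : ℝ) (v : Config L M → ℂ) :
    H0 L t Δ x (embed L M Δ v)
      = embed L M Δ ((sectorMatrix L M t Δ x).map Complex.ofReal *ᵥ v) := by
  have hcol : ∀ S : Config L M, H0 L t Δ x (sectorKet Δ S)
      = ∑ T, (sectorMatrix L M t Δ x T S : ℂ) • sectorKet Δ T := by
    intro S
    have h1 : ∀ T, (sectorMatrix L M t Δ x T S : ℂ) • sectorKet Δ T
        = -(∑ j, if S.toggle j = T then (bondWeight t Δ j S.1 : ℂ) • sectorKet Δ T else 0)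
          - if S = T then ((x * filling L M S : ℝ) : ℂ) • sectorKet Δ T else 0 := by
      intro T
      have h2 : (∑ j, if S.toggle j = T then (bondWeight t Δ j S.1 : ℂ) • sectorKet Δ T else 0)
          = (∑ j, if S.toggle j = T then (bondWeight t Δ j S.1 : ℂ) else 0) • sectorKet Δ T := by
        rw [Finset.sum_smul]
        exact Finset.sum_congr rfl fun j _ => by split_ifs <;> simp
      rw [h2, sectorMatrix, Matrix.sub_apply, Matrix.smul_apply, bondMatrix, of_apply, diagonal_apply]
      by_cases hST : S = T
      · subst hST
        simp only [if_true]
        push_cast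
        simp only [apply_ite Complex.ofReal, Complex.ofReal_zero, smul_eq_mul]
        push_cast
        module
      · rw [if_neg hST, if_neg (Ne.symm hST)]
        push_cast
        simp only [apply_ite Complex.ofReal, Complex.ofReal_zero, smul_zero]
        module
    rw [H0_sectorKet, Finset.sum_congr rfl fun T _ => h1 T, Finset.sum_sub_distrib,
      Finset.sum_neg_distrib, Finset.sum_comm]
    simp
  rw [embed_eq_sum, map_sum, embed_eq_sum]
  simp only [map_smul, hcol, mulVec, dotProduct, map_apply, Finset.smul_sum, Finset.sum_smul]
  rw [Finset.sum_comm]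
  refine Finset.sum_congr rfl fun T _ => Finset.sum_congr rfl fun S _ => ?_
  rw [smul_smul, mul_comm]

lemma bondMatrix_isSymm (t Δ : ℝ) : (bondMatrix L M t Δ).IsSymm := by
  ext S T
  simp only [transpose_apply, bondMatrix, of_apply]
  congr 1
  refine Finset.sum_congr rfl fun j _ => ?_
  by_cases h : S.toggle j = T
  · subst h
    rw [if_pos rfl, if_pos (Config.toggle_toggle j S)]
    exact (bondWeight_toggle t Δ j S.1).symm
  · rw [if_neg h, if_neg]
    rintro rfl
    exact h (Config.toggle_toggle j T)

lemma sectorMatrix_isSymm (t Δ x : ℝ) : (sectorMatrix L M t Δ x).IsSymm :=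
  (bondMatrix_isSymm t Δ).sub ((isSymm_diagonal _).smul x)

lemma bondMatrix_nonpos {t Δ : ℝ} (ht : 0 < t) (hΔ : Δ ≠ 0) (S T : Config L M) :
    bondMatrix L M t Δ S T ≤ 0 := by
  rw [bondMatrix, of_apply, neg_nonpos]
  refine Finset.sum_nonneg fun j _ => ?_
  split_ifs
  exacts [(bondWeight_pos ht hΔ j _).le, le_rfl]

lemma sectorMatrix_nonpos_of_ne {t Δ : ℝ} (ht : 0 < t) (hΔ : Δ ≠ 0) (x : ℝ) {S T : Config L M}
    (h : S ≠ T) : sectorMatrix L M t Δ x S T ≤ 0 := by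
  simpa [sectorMatrix, diagonal_apply_ne _ h] using bondMatrix_nonpos ht hΔ S T

lemma sectorMatrix_toggle_ne_zero {t Δ : ℝ} (ht : 0 < t) (hΔ : Δ ≠ 0) (x : ℝ) (j : Fin (L - 1))
    (S : Config L M) : sectorMatrix L M t Δ x S (S.toggle j) ≠ 0 := by
  rw [sectorMatrix, Matrix.sub_apply, Matrix.smul_apply, diagonal_apply_ne _ (Config.toggle_ne j S).symm,
    smul_zero, sub_zero, bondMatrix, of_apply]
  refine neg_ne_zero.2 (ne_of_gt ?_)
  refine Finset.sum_pos' (fun i _ => ?_) ⟨j, Finset.mem_univ j, ?_⟩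
  · split_ifs
    exacts [(bondWeight_pos ht hΔ i _).le, le_rfl]
  · rw [if_pos (Config.toggle_toggle j S)]
    exact bondWeight_pos ht hΔ j _

lemma sectorMatrix_connected {t Δ : ℝ} (ht : 0 < t) (hΔ : Δ ≠ 0) (x : ℝ) :
    (sectorMatrix L M t Δ x).EntriesConnected := by
  intro P hP S T hS
  -- `P` lives on the subtype; quantifying over the parity proof extends it to all configurations.
  refine toggle_connected (fun U => ∀ h : (2 : ℤ) ∣ M - U.card, P ⟨U, h⟩) ?_ (S := S.1) (T := T.1)
    ?_ (fun _ => hS) T.2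
  · intro j U hU h
    have h1 := card_toggle j U
    have hU2 : (2 : ℤ) ∣ M - U.card := by split_ifs at h1 <;> omega
    exact hP ⟨U, hU2⟩ _ (hU hU2) (sectorMatrix_toggle_ne_zero ht hΔ x j ⟨U, hU2⟩)
  · have h1 := S.2
    have h2 := T.2
    omega

end Wire

/-! ### Complex eigenvectors of real matrices -/

namespace Matrix

variable {ι : Type*} [Fintype ι]

lemma re_map_ofReal_mulVec (A : Matrix ι ι ℝ) (v : ι → ℂ) :
    (fun i => ((A.map Complex.ofReal *ᵥ v) i).re) = A *ᵥ fun i => (v i).re := by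
  funext i
  simp [mulVec, dotProduct, Complex.re_sum]

lemma im_map_ofReal_mulVec (A : Matrix ι ι ℝ) (v : ι → ℂ) :
    (fun i => ((A.map Complex.ofReal *ᵥ v) i).im) = A *ᵥ fun i => (v i).im := by
  funext i
  simp [mulVec, dotProduct, Complex.im_sum]

lemma mulVec_re_of_map_ofReal {A : Matrix ι ι ℝ} {v : ι → ℂ} {e : ℝ}
    (h : A.map Complex.ofReal *ᵥ v = (e : ℂ) • v) :
    A *ᵥ (fun i => (v i).re) = e • fun i => (v i).re := by
  rw [← re_map_ofReal_mulVec, h]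
  funext i
  simp

lemma mulVec_im_of_map_ofReal {A : Matrix ι ι ℝ} {v : ι → ℂ} {e : ℝ}
    (h : A.map Complex.ofReal *ᵥ v = (e : ℂ) • v) :
    A *ᵥ (fun i => (v i).im) = e • fun i => (v i).im := by
  rw [← im_map_ofReal_mulVec, h]
  funext i
  simp

lemma map_ofReal_mulVec_of_mulVec_eq {A : Matrix ι ι ℝ} {u : ι → ℝ} {e : ℝ}
    (h : A *ᵥ u = e • u) (z : ℂ) :
    A.map Complex.ofReal *ᵥ (fun i => z * (u i : ℂ)) = (e : ℂ) • fun i => z * (u i : ℂ) := by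
  funext i
  have h1 := congrArg Complex.ofReal (congrFun h i)
  simp only [mulVec, dotProduct, Pi.smul_apply, smul_eq_mul, map_apply] at h1 ⊢
  push_cast at h1
  calc ∑ j, (A i j : ℂ) * (z * (u j : ℂ)) = z * ∑ j, (A i j : ℂ) * (u j : ℂ) := by
        rw [Finset.mul_sum]; exact Finset.sum_congr rfl fun j _ => by ring
    _ = (e : ℂ) * (z * (u i : ℂ)) := by rw [h1]; ring

/-- The real and imaginary parts satisfy the same real eigenvector equation, and one of them is
nonzero. -/
lemma IsMinEigenvector.le_of_complex {A : Matrix ι ι ℝ} {ε e : ℝ} {u : ι → ℝ}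
    (hu : A.IsMinEigenvector ε u) {v : ι → ℂ} (hv0 : v ≠ 0)
    (hv : A.map Complex.ofReal *ᵥ v = (e : ℂ) • v) : ε ≤ e := by
  by_cases hre : (fun i => (v i).re) = 0
  · refine hu.eigenvalue_le (mulVec_im_of_map_ofReal hv) fun him => hv0 ?_
    funext i
    exact Complex.ext (congrFun hre i) (congrFun him i)
  · exact hu.eigenvalue_le (mulVec_re_of_map_ofReal hv) hre

end Matrix

/-! ### Ground states and the mean particle number -/

namespace Wire

open Matrix

variable {L : ℕ} {M : ℤ}

/-- The real and imaginary parts of the amplitudes of a ground state are both real multiples of `u`,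
so together they form one complex multiple, and normalization makes it a phase. -/
lemma isGroundState_iff {t Δ : ℝ} (ht : 0 < t) (hΔ : Δ ≠ 0) {x ε : ℝ} {u : Config L M → ℝ}
    (hu : u ⬝ᵥ u = 1) (hε : (sectorMatrix L M t Δ x).IsMinEigenvector ε u) {χ : State L} :
    IsGroundState (H0 L t Δ x) M χ ↔
      ∃ z : ℂ, ‖z‖ = 1 ∧ χ = embed L M Δ fun S => z * (u S : ℂ) := by
  have hu0 : u ≠ 0 := fun h => by simp [h] at hu
  have hnorm : ∀ z : ℂ, braket (embed L M Δ fun S => z * (u S : ℂ))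
      (embed L M Δ fun S => z * (u S : ℂ)) = ((‖z‖ ^ 2 : ℝ) : ℂ) := by
    intro z
    have h1 : ∀ S, conj (z * (u S : ℂ)) * (z * (u S : ℂ))
        = ((‖z‖ ^ 2 : ℝ) : ℂ) * ((u S * u S : ℝ) : ℂ) := by
      intro S
      rw [map_mul, Complex.conj_ofReal]
      push_cast
      rw [← Complex.conj_mul']
      ring
    rw [braket_embed, Finset.sum_congr rfl fun S _ => h1 S, ← Finset.mul_sum,
      ← Complex.ofReal_sum]
    change _ * ((u ⬝ᵥ u : ℝ) : ℂ) = _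
    rw [hu, Complex.ofReal_one, mul_one]
  have heig : ∀ z : ℂ, H0 L t Δ x (embed L M Δ fun S => z * (u S : ℂ))
      = (ε : ℂ) • embed L M Δ fun S => z * (u S : ℂ) := by
    intro z
    rw [H0_embed, map_ofReal_mulVec_of_mulVec_eq hε.mulVec_eq, map_smul]
  have hmat : ∀ (e : ℝ) (v : Config L M → ℂ),
      H0 L t Δ x (embed L M Δ v) = (e : ℂ) • embed L M Δ v →
        (sectorMatrix L M t Δ x).map Complex.ofReal *ᵥ v = (e : ℂ) • v := by
    intro e v h
    rw [H0_embed, ← map_smul] at h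
    exact embed_injective Δ h
  constructor
  · rintro ⟨hχ, hχ1, e, he, hmin⟩
    obtain ⟨v, rfl⟩ := (mem_sector_iff_exists_embed Δ).1 hχ
    have hv := hmat e v he
    have hv0 : v ≠ 0 := by
      rintro rfl
      simp [braket] at hχ1
    -- The embedded `u` is itself an eigenvector in the sector and competes with `χ`.
    have hle : e ≤ ε := by
      refine hmin ε _ ((mem_sector_iff_exists_embed Δ).2 ⟨_, rfl⟩) (fun h0 => ?_) (heig 1)
      have := hnorm 1
      rw [h0] at this
      simp [braket] at this
    obtain rfl := le_antisymm hle (hε.le_of_complex hv0 hv)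
    have hsymm := sectorMatrix_isSymm (L := L) (M := M) t Δ x
    have hoff := fun (S T : Config L M) (h : S ≠ T) => sectorMatrix_nonpos_of_ne (M := M) ht hΔ x h
    have hconn := sectorMatrix_connected (L := L) (M := M) ht hΔ x
    obtain ⟨a, ha⟩ := hε.exists_eq_smul hsymm hoff hconn hu0 (mulVec_re_of_map_ofReal hv)
    obtain ⟨b, hb⟩ := hε.exists_eq_smul hsymm hoff hconn hu0 (mulVec_im_of_map_ofReal hv)
    have hvz : v = fun S => (⟨a, b⟩ : ℂ) * (u S : ℂ) := by
      funext S
      refine Complex.ext ?_ ?_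
      · simpa using congrFun ha S
      · simpa using congrFun hb S
    refine ⟨⟨a, b⟩, ?_, by rw [hvz]⟩
    rw [hvz, hnorm] at hχ1
    have h2 : ‖(⟨a, b⟩ : ℂ)‖ ^ 2 = 1 := by exact_mod_cast hχ1
    exact (pow_eq_one_iff_of_nonneg (norm_nonneg _) two_ne_zero).1 h2
  · rintro ⟨z, hz, rfl⟩
    refine ⟨(mem_sector_iff_exists_embed Δ).2 ⟨_, rfl⟩, by rw [hnorm, hz]; simp, ε, heig z, ?_⟩
    intro e ψ hψ hψ0 he
    obtain ⟨v, rfl⟩ := (mem_sector_iff_exists_embed Δ).1 hψ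
    refine hε.le_of_complex (fun h => hψ0 ?_) (hmat e v he)
    rw [h, map_zero]

lemma exists_isMinEigenvector_sectorMatrix (hL : 1 ≤ L) (M : ℤ) (t Δ x : ℝ) :
    ∃ (ε : ℝ) (u : Config L M → ℝ), u ⬝ᵥ u = 1 ∧
      (sectorMatrix L M t Δ x).IsMinEigenvector ε u :=
  have := Config.nonempty (M := M) hL
  exists_isMinEigenvector (sectorMatrix_isSymm t Δ x)

lemma exists_isGroundState (hL : 1 ≤ L) (M : ℤ) {t Δ : ℝ} (ht : 0 < t) (hΔ : Δ ≠ 0) (x : ℝ) :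
    ∃ χ : State L, IsGroundState (H0 L t Δ x) M χ := by
  obtain ⟨ε, u, hu, hε⟩ := exists_isMinEigenvector_sectorMatrix hL M t Δ x
  exact ⟨_, (isGroundState_iff ht hΔ hu hε).2 ⟨1, norm_one, rfl⟩⟩

lemma IsGroundState.exists_phase (hL : 1 ≤ L) {t Δ x : ℝ} (ht : 0 < t) (hΔ : Δ ≠ 0)
    {χ χ' : State L} (h : IsGroundState (H0 L t Δ x) M χ)
    (h' : IsGroundState (H0 L t Δ x) M χ') : ∃ z : ℂ, ‖z‖ = 1 ∧ χ' = z • χ := by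
  obtain ⟨ε, u, hu, hε⟩ := exists_isMinEigenvector_sectorMatrix hL M t Δ x
  obtain ⟨z, hz, rfl⟩ := (isGroundState_iff ht hΔ hu hε).1 h
  obtain ⟨z', hz', rfl⟩ := (isGroundState_iff ht hΔ hu hε).1 h'
  have hz0 : z ≠ 0 := norm_ne_zero_iff.1 (by rw [hz]; exact one_ne_zero)
  refine ⟨z' / z, by rw [norm_div, hz, hz', div_one], ?_⟩
  rw [← map_smul]
  congr 1
  funext S
  simp only [Pi.smul_apply, smul_eq_mul]
  field_simp

/-- The chosen ground state differs from `u` by a phase, which cancels in the expectation value; `L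
/ 2` undoes the offset in `filling`. -/
lemma meanWireNumber_eq {t Δ : ℝ} (ht : 0 < t) (hΔ : Δ ≠ 0) {x ε : ℝ} {u : Config L M → ℝ}
    (hu : u ⬝ᵥ u = 1) (hε : (sectorMatrix L M t Δ x).IsMinEigenvector ε u) :
    meanWireNumber L t Δ M x = u ⬝ᵥ diagonal (filling L M) *ᵥ u + L / 2 := by
  have hex : ∃ χ : State L, IsGroundState (H0 L t Δ x) M χ :=
    ⟨_, (isGroundState_iff ht hΔ hu hε).2 ⟨1, norm_one, rfl⟩⟩
  obtain ⟨z, hz, hχ⟩ := (isGroundState_iff ht hΔ hu hε).1 hex.choose_spec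
  have h1 : ∀ S : Config L M, conj (z * (u S : ℂ)) * ((S.1.card : ℂ) * (z * (u S : ℂ)))
      = ((u S * (S.1.card * u S) : ℝ) : ℂ) := by
    intro S
    have hzz : conj z * z = 1 := by rw [Complex.conj_mul', hz]; simp
    rw [map_mul, Complex.conj_ofReal]
    push_cast
    linear_combination ((u S : ℂ) * (S.1.card * u S)) * hzz
  rw [meanWireNumber, dif_pos hex, hχ, wireNumber_embed, braket_embed,
    Finset.sum_congr rfl fun S _ => h1 S, ← Complex.ofReal_sum, Complex.ofReal_re]
  have h2 : (L : ℝ) / 2 = ∑ S, u S * (L / 2 * u S) := by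
    calc (L : ℝ) / 2 = L / 2 * (u ⬝ᵥ u) := by rw [hu, mul_one]
      _ = _ := by
        rw [dotProduct, Finset.mul_sum]
        exact Finset.sum_congr rfl fun S _ => by ring
  rw [h2, dotProduct, ← Finset.sum_add_distrib]
  refine Finset.sum_congr rfl fun S _ => ?_
  rw [mulVec_diagonal, filling]
  ring

lemma isGroundMean_meanWireNumber (hL : 1 ≤ L) (M : ℤ) {t Δ : ℝ} (ht : 0 < t) (hΔ : Δ ≠ 0) :
    IsGroundMean (bondMatrix L M t Δ) (filling L M)
      fun x => meanWireNumber L t Δ M x - L / 2 := by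
  intro x
  obtain ⟨ε, u, hu, hε⟩ := exists_isMinEigenvector_sectorMatrix hL M t Δ x
  exact ⟨ε, u, hu, hε, sub_eq_of_eq_add (meanWireNumber_eq ht hΔ hu hε)⟩

lemma monotone_meanWireNumber (hL : 1 ≤ L) (M : ℤ) {t Δ : ℝ} (ht : 0 < t) (hΔ : Δ ≠ 0) :
    Monotone (meanWireNumber L t Δ M) := fun _ _ hxy =>
  (sub_le_sub_iff_right _).1 ((isGroundMean_meanWireNumber hL M ht hΔ).monotone hxy)

lemma continuous_meanWireNumber (hL : 1 ≤ L) (M : ℤ) {t Δ : ℝ} (ht : 0 < t) (hΔ : Δ ≠ 0) :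
    Continuous (meanWireNumber L t Δ M) := by
  have h := (isGroundMean_meanWireNumber hL M ht hΔ).continuous (bondMatrix_isSymm t Δ)
    (fun S T _ => bondMatrix_nonpos ht hΔ S T) (sectorMatrix_connected ht hΔ)
  simpa using h.add_const ((L : ℝ) / 2)

/-! ### The self-consistency equation -/

/-- A self-consistency equation `a = y + k f(y)` with `f` monotone and continuous has exactly one
solution in `(-t, t)` if `a` lies between the values of `y + k f(x)` at `y = ± t`. -/
lemma existsUnique_add_mul_eq {f : ℝ → ℝ} (hmono : Monotone f) (hcont : Continuous f)
    {k t x a : ℝ} (hk : 0 ≤ k) (hx : |x| < t) (hlow : -t + k * f x < a) (hupp : a < t + k * f x) :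
    ∃! y : ℝ, y ∈ Set.Ioo (-t) t ∧ a = y + k * f y := by
  obtain ⟨hx1, hx2⟩ := abs_lt.1 hx
  have hg : StrictMono fun y => y + k * f y :=
    strictMono_id.add_monotone (hmono.const_mul hk)
  -- The interval `[-l, r]` lies strictly inside `(-t, t)` and contains `x`. Monotonicity therefore
  -- compares `f` at its ends with the `f x` of the hypotheses, and `l`, `r` are large enough that
  -- `a` is bracketed.
  set l := max (-x) (k * f x - a) with hl
  set r := max x (a - k * f x) with hr
  have hlt : l < t := max_lt (by linarith) (by linarith)
  have hrt : r < t := max_lt hx2 (by linarith)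
  have hxl : -l ≤ x := by linarith [le_max_left (-x) (k * f x - a)]
  have hxr : x ≤ r := le_max_left _ _
  have hal : -l + k * f (-l) ≤ a := by
    have := mul_le_mul_of_nonneg_left (hmono hxl) hk
    linarith [le_max_right (-x) (k * f x - a)]
  have har : a ≤ r + k * f r := by
    have := mul_le_mul_of_nonneg_left (hmono hxr) hk
    linarith [le_max_right x (a - k * f x)]
  obtain ⟨y, hy, hya⟩ := intermediate_value_Icc (hxl.trans hxr)
    (f := fun y => y + k * f y) (by fun_prop) ⟨hal, har⟩
  refine ⟨y, ⟨⟨by linarith [hy.1], by linarith [hy.2]⟩, hya.symm⟩, ?_⟩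
  rintro z ⟨-, hz⟩
  exact hg.injective (hz.symm.trans hya.symm)

/-! ### The charging energy on the sector -/

lemma wireNumber_mem_sector {ψ : State L} (hψ : ψ ∈ sector L M) :
    wireNumber L ψ ∈ sector L M := by
  -- Any gauge parameter parametrizes the sector; `1` is arbitrary.
  obtain ⟨v, rfl⟩ := (mem_sector_iff_exists_embed 1).1 hψ
  rw [wireNumber_embed]
  exact (mem_sector_iff_exists_embed 1).2 ⟨_, rfl⟩

lemma two_smul_pairNumber_of_mem_sector {ψ : State L} (hψ : ψ ∈ sector L M) :
    (2 : ℂ) • pairNumber L ψ = (M : ℂ) • ψ - wireNumber L ψ := by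
  have h := Module.End.mem_eigenspace_iff.1 hψ
  rw [← h, totalNumber, LinearMap.add_apply, LinearMap.smul_apply, add_sub_cancel_left]

/-- On the sector `2 n = M - N_w`. This is applied twice, which is legitimate because `N_w`
preserves the sector. -/
lemma charging_of_mem_sector (Ec nc : ℝ) {ψ : State L} (hψ : ψ ∈ sector L M) :
    charging L Ec nc ψ = (Ec : ℂ) • (wireNumber L (wireNumber L ψ)
      - (2 * ((M : ℂ) - 2 * nc)) • wireNumber L ψ + ((M : ℂ) - 2 * nc) ^ 2 • ψ) := by
  have hstep : ∀ φ ∈ sector L M,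
      ((2 : ℂ) • pairNumber L - ((2 * nc : ℝ) : ℂ) • 1) φ
        = ((M : ℂ) - 2 * nc) • φ - wireNumber L φ := by
    intro φ hφ
    rw [LinearMap.sub_apply, LinearMap.smul_apply, LinearMap.smul_apply, Module.End.one_apply,
      two_smul_pairNumber_of_mem_sector hφ]
    push_cast
    module
  rw [charging, LinearMap.smul_apply, pow_two, Module.End.mul_apply, hstep ψ hψ,
    hstep _ ((sector L M).sub_mem ((sector L M).smul_mem _ hψ) (wireNumber_mem_sector hψ)),
    map_sub, map_smul]
  module

end Wire

theorem lemma1 (L : ℕ) (hL : 1 ≤ L) (t Δ Ec nc μ : ℝ) (M : ℤ)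
    (hΔ : Δ ≠ 0) (hEc : 0 ≤ Ec) (hμ : |μ| < t)
    (hlow : -t + 2 * Ec * Wire.meanWireNumber L t Δ M μ < μ + 2 * Ec * ((M : ℝ) - 2 * nc))
    (hupp : μ + 2 * Ec * ((M : ℝ) - 2 * nc) < t + 2 * Ec * Wire.meanWireNumber L t Δ M μ) :
    -- for `|x| < t` the ground state of `H_{0,x}` in the sector exists and is unique up to a phase
    (∀ x : ℝ, |x| < t →
      (∃ χ : Wire.State L, Wire.IsGroundState (Wire.H0 L t Δ x) M χ) ∧
      ∀ χ χ' : Wire.State L, Wire.IsGroundState (Wire.H0 L t Δ x) M χ →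
        Wire.IsGroundState (Wire.H0 L t Δ x) M χ' → ∃ z : ℂ, ‖z‖ = 1 ∧ χ' = z • χ) ∧
    (∃! μ' : ℝ, μ' ∈ Set.Ioo (-t) t ∧
      μ + 2 * Ec * ((M : ℝ) - 2 * nc) = μ' + 2 * Ec * Wire.meanWireNumber L t Δ M μ') ∧
    ∀ μ' : ℝ, μ' ∈ Set.Ioo (-t) t →
      μ + 2 * Ec * ((M : ℝ) - 2 * nc) = μ' + 2 * Ec * Wire.meanWireNumber L t Δ M μ' →
      ∀ ψ ∈ Wire.sector L M,
        Wire.H L t Δ Ec nc μ ψ =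
          ((Wire.H0 L t Δ μ'
            + (Ec : ℂ) • (Wire.wireNumber L
                - ((Wire.meanWireNumber L t Δ M μ' : ℝ) : ℂ) • 1) ^ 2
            + (((μ - μ') * ((L : ℝ) / 2) + Ec * ((M : ℝ) - 2 * nc) ^ 2
                - Ec * (Wire.meanWireNumber L t Δ M μ') ^ 2 : ℝ) : ℂ) • 1 :
              Module.End ℂ (Wire.State L)) ψ) := by
  have ht : 0 < t := (abs_nonneg μ).trans_lt hμ
  refine ⟨fun x _ => ⟨Wire.exists_isGroundState hL M ht hΔ x,
    fun χ χ' h h' => h.exists_phase hL ht hΔ h'⟩, ?_, ?_⟩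
  · exact Wire.existsUnique_add_mul_eq (Wire.monotone_meanWireNumber hL M ht hΔ)
      (Wire.continuous_meanWireNumber hL M ht hΔ) (by positivity) hμ hlow hupp
  · intro μ' _ hμ' ψ hψ
    rw [Wire.H, LinearMap.add_apply, Wire.charging_of_mem_sector Ec nc hψ, Wire.H0, Wire.H0]
    generalize Wire.meanWireNumber L t Δ M μ' = f at hμ' ⊢
    have hC : (μ : ℂ) + 2 * Ec * (M - 2 * nc) = μ' + 2 * Ec * f := by exact_mod_cast hμ'
    -- Substituting for `μ` matches the terms linear in `N_w`; the constants then agree by the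
    -- choice of `𝒞`, and what is left is linear algebra over `ψ`, `N_w ψ`, `N_w² ψ` and the bond
    -- terms.
    have hμC : (μ : ℂ) = μ' + 2 * Ec * f - 2 * Ec * (M - 2 * nc) := by linear_combination hC
    simp only [LinearMap.add_apply, LinearMap.sub_apply, LinearMap.smul_apply, pow_two,
      Module.End.mul_apply, Module.End.one_apply, map_sub, map_smul]
    push_cast
    rw [hμC]
    module
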